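/- Let $S^1=\{z\in\mathbb C:|z|=1\}$. For $u\neq v$ in $S^1$ let $(u,v)_{S^1}$ denote the open arc running counterclockwise from $u$ to $v$; such sets are called nondegenerate open intervals, and the dual of $I=(u,v)_{S^1}$ is $I^*=(v,u)_{S^1}$. For nondegenerate open intervals $I,J$, the pair $\{I,I^*\}$ is said to lie on $J$ if $I\subseteq J$ or $I^*\subseteq J$. A lamination system on $S^1$ is a nonempty family $\mathcal L$ of nondegenerate open intervals such that (1) $I\in\mathcal L$ implies $I^*\in\mathcal L$; (2) for all $I,J\in\mathcal L$, $\{I,I^*\}$ lies on $J$ or on $J^*$; (3) if $I_1\subseteq I_2\subseteq\cdots$ is a sequence in $\mathcal L$ whose union is a nondegenerate open interval, then $\bigcup_n I_n\in\mathcal L$. A leaf of $\mathcal L$ is a set $\{I,I^*\}$ with $I\in\mathcal L$. A gap of $\mathcal L$ is a subset $\mathcal G\subseteq\mathcal L$ whose elements are pairwise disjoint and such that for every $I\in\mathcal L$ there is $J\in\mathcal G$ on which $\{I,I^*\}$ lies; its vertex set is $v(\mathcal G)=S^1\setminus\bigcup_{I\in\mathcal G}I$. An ideal polygon of $\mathcal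 L$ is a gap whose vertex set is finite. Let $\mathrm{Homeo}^+(S^1)$ be the group of orientation-preserving homeomorphisms of $S^1$. For a subgroup $G$ of it, $\mathcal L$ is $G$-invariant if $g(I)\in\mathcal L$ for all $I\in\mathcal L$ and $g\in G$. Write $g(\mathcal G)=\{g(I):I\in\mathcal G\}$ and $v_G(\mathcal G)=\bigcup_{g\in G}v(g(\mathcal G))$. **Theorem.** Let $G$ be a subgroup of $\mathrm{Homeo}^+(S^1)$ and let $\mathcal L$ be a $G$-invariant lamination system on $S^1$. Suppose that $\mathcal G_0$ is an ideal polygon of $\mathcal L$ which is not a leaf, and that $v_G(\mathcal G_0)$ is dense in $S^1$. Then $G$ is not virtually abelian, i.e. $G$ has no abelian subgroup of finite index. -/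

import Mathlib

namespace CircleLamination

/-- The stereographic projection `S¹ ∖ {1} → ℝ`, `z ↦ Im z / (Re z - 1)`. It increases from
`-∞` to `∞` as `z` runs counterclockwise through `S¹ ∖ {1}`; it is only used away from `1`. -/
noncomputable def stereo (z : Circle) : ℝ := (z : ℂ).im / ((z : ℂ).re - 1)

/-- `(x, y, z)` is a positively oriented triple of (distinct) points of `S¹`. -/
def PosOriented (x y z : Circle) : Prop :=
  x ≠ y ∧ y ≠ z ∧ x ≠ z ∧ stereo (x⁻¹ * y) < stereo (x⁻¹ * z)

/-- For `u ≠ v`, the nondegenerate open interval `(u, v)` of `S¹`. -/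
def arc (u v : Circle) : Set Circle := {p | PosOriented u p v}

/-- `I` is a nondegenerate open interval of `S¹`. -/
def IsNondegInterval (I : Set Circle) : Prop := ∃ u v : Circle, u ≠ v ∧ I = arc u v

/-- The dual interval: `dual (u, v) = (v, u)`, see `dual_arc`. -/
def dual (I : Set Circle) : Set Circle :=
  {p | ∃ u v : Circle, u ≠ v ∧ I = arc u v ∧ p ∈ arc v u}

/-! ### Facts on the circular order: orientation is the sign of a determinant -/

/-- Twice the signed area of the triangle `x y z`. -/
noncomputable def cross (x y z : Circle) : ℝ :=
  ((y : ℂ).re - (x : ℂ).re) * ((z : ℂ).im - (x : ℂ).im) -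
    ((y : ℂ).im - (x : ℂ).im) * ((z : ℂ).re - (x : ℂ).re)

theorem re_sq_add_im_sq (z : Circle) : (z : ℂ).re ^ 2 + (z : ℂ).im ^ 2 = 1 := by
  have h := Circle.normSq_coe z
  rw [Complex.normSq_apply] at h
  linarith

theorem re_lt_one {z : Circle} (hz : z ≠ 1) : (z : ℂ).re < 1 := by
  have h := re_sq_add_im_sq z
  by_contra hc
  push Not at hc
  apply hz
  have h1 : (z : ℂ).im = 0 := by nlinarith [sq_nonneg (z : ℂ).im]
  have h2 : (z : ℂ).re = 1 := by nlinarith [sq_nonneg (z : ℂ).im]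
  exact Circle.ext (Complex.ext (by simpa using h2) (by simpa using h1))

theorem inv_mul_re (x y : Circle) : ((x⁻¹ * y : Circle) : ℂ).re =
    (x : ℂ).re * (y : ℂ).re + (x : ℂ).im * (y : ℂ).im := by
  simp

theorem inv_mul_im (x y : Circle) : ((x⁻¹ * y : Circle) : ℂ).im =
    (x : ℂ).re * (y : ℂ).im - (x : ℂ).im * (y : ℂ).re := by
  simp
  ring

theorem cross_eq (x y z : Circle) : cross x y z =
    ((x⁻¹ * y : Circle) : ℂ).im * (1 - ((x⁻¹ * z : Circle) : ℂ).re) -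
      ((x⁻¹ * z : Circle) : ℂ).im * (1 - ((x⁻¹ * y : Circle) : ℂ).re) := by
  have hx := re_sq_add_im_sq x
  rw [inv_mul_re, inv_mul_re, inv_mul_im, inv_mul_im, cross]
  linear_combination ((z : ℂ).re * (y : ℂ).im - (z : ℂ).im * (y : ℂ).re) * (hx)

theorem stereo_lt_iff {x y z : Circle} (hy : x ≠ y) (hz : x ≠ z) :
    stereo (x⁻¹ * y) < stereo (x⁻¹ * z) ↔ 0 < cross x y z := by
  have h1 := re_lt_one (fun h => hy (inv_mul_eq_one.mp h) : x⁻¹ * y ≠ 1)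
  have h2 := re_lt_one (fun h => hz (inv_mul_eq_one.mp h) : x⁻¹ * z ≠ 1)
  rw [cross_eq, stereo, stereo, ← neg_div_neg_eq, ← neg_div_neg_eq (a := (_ : ℂ).im) (b := _),
    div_lt_div_iff₀ (by linarith) (by linarith)]
  constructor <;> intro h <;> linarith

theorem cross_ne_zero {x y z : Circle} (hy : x ≠ y) (hyz : y ≠ z) (hz : x ≠ z) :
    cross x y z ≠ 0 := by
  intro h0
  have h1 := re_lt_one (fun h => hy (inv_mul_eq_one.mp h) : x⁻¹ * y ≠ 1)
  have h2 := re_lt_one (fun h => hz (inv_mul_eq_one.mp h) : x⁻¹ * z ≠ 1)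
  rw [cross_eq] at h0
  have ha := re_sq_add_im_sq (x⁻¹ * y)
  have hb := re_sq_add_im_sq (x⁻¹ * z)
  have hne : x⁻¹ * y ≠ x⁻¹ * z := fun h => hyz (mul_left_cancel h)
  generalize x⁻¹ * y = a at *
  generalize x⁻¹ * z = b at *
  have e : ((1 - (a : ℂ).re) * (1 - (b : ℂ).re)) * ((a : ℂ).re - (b : ℂ).re) = 0 := by
    have e1 : (a : ℂ).im * (1 - (b : ℂ).re) = (b : ℂ).im * (1 - (a : ℂ).re) := by linarith
    have e2 : (a : ℂ).im ^ 2 * (1 - (b : ℂ).re) ^ 2 = (b : ℂ).im ^ 2 * (1 - (a : ℂ).re) ^ 2 := by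
      rw [← mul_pow, e1, mul_pow]
    have ha' : (a : ℂ).im ^ 2 = 1 - (a : ℂ).re ^ 2 := by linarith
    have hb' : (b : ℂ).im ^ 2 = 1 - (b : ℂ).re ^ 2 := by linarith
    rw [ha', hb'] at e2
    linear_combination e2 / 2
  have e3 : (a : ℂ).re = (b : ℂ).re := by
    rcases mul_eq_zero.mp e with h | h
    · exact absurd h (mul_pos (by linarith) (by linarith)).ne'
    · linarith
  have e4 : (a : ℂ).im = (b : ℂ).im := by
    rw [e3, ← sub_mul] at h0
    rcases mul_eq_zero.mp h0 with h | h <;> linarith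
  exact hne (Circle.ext (Complex.ext e3 e4))

theorem posOriented_iff {x y z : Circle} : PosOriented x y z ↔ 0 < cross x y z := by
  constructor
  · rintro ⟨h1, -, h3, h4⟩
    exact (stereo_lt_iff h1 h3).mp h4
  · intro h
    have h1 : x ≠ y := by rintro rfl; simp [cross] at h
    have h2 : y ≠ z := by
      rintro rfl
      unfold cross at h
      linarith
    have h3 : x ≠ z := by rintro rfl; simp [cross] at h
    exact ⟨h1, h2, h3, (stereo_lt_iff h1 h3).mpr h⟩

theorem PosOriented.rotate {x y z : Circle} (h : PosOriented x y z) : PosOriented y z x := by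
  rw [posOriented_iff] at *
  unfold cross at *
  linarith

theorem PosOriented.asymm {x y z : Circle} (h : PosOriented x y z) : ¬ PosOriented x z y :=
  fun h' => lt_asymm h.2.2.2 h'.2.2.2

theorem posOriented_total {x y z : Circle} (hy : x ≠ y) (hyz : y ≠ z) (hz : x ≠ z) :
    PosOriented x y z ∨ PosOriented x z y := by
  rcases lt_or_gt_of_ne (cross_ne_zero hy hyz hz) with h | h
  · right
    rw [posOriented_iff]
    unfold cross at *
    linarith
  · exact Or.inl (posOriented_iff.mpr h)

theorem PosOriented.trans {q x y z : Circle} (h : PosOriented q x y) (h' : PosOriented q y z) :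
    PosOriented q x z := by
  have hs := h.2.2.2.trans h'.2.2.2
  refine ⟨h.1, ?_, h'.2.2.1, hs⟩
  rintro rfl
  exact lt_irrefl _ hs

theorem PosOriented.inner {q x y z : Circle} (h : PosOriented q x y) (h' : PosOriented q y z) :
    PosOriented x y z :=
  (h'.rotate.trans h.rotate.rotate).rotate.rotate

theorem exists_stereo_eq (t : ℝ) : ∃ z : Circle, z ≠ 1 ∧ stereo z = t := by
  have ht : (0 : ℝ) < t ^ 2 + 1 := by positivity
  refine ⟨⟨⟨(t ^ 2 - 1) / (t ^ 2 + 1), -2 * t / (t ^ 2 + 1)⟩, ?_⟩, ?_, ?_⟩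
  · rw [Submonoid.unitSphere, ← SetLike.mem_coe]
    simp only [Submonoid.coe_set_mk, Subsemigroup.coe_set_mk, mem_sphere_zero_iff_norm]
    rw [← sq_eq_sq₀ (norm_nonneg _) zero_le_one, ← Complex.normSq_eq_norm_sq,
      Complex.normSq_apply]
    field_simp
    ring
  · intro h
    have := congrArg (fun z : Circle => (z : ℂ).re) h
    simp only [Circle.coe_one, Complex.one_re] at this
    rw [div_eq_one_iff_eq ht.ne'] at this
    linarith
  · have : (t ^ 2 - 1) / (t ^ 2 + 1) - 1 = -2 / (t ^ 2 + 1) := by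
      field_simp
      ring
    simp only [stereo, this]
    field_simp

theorem arc_nonempty {u v : Circle} (h : u ≠ v) : (arc u v).Nonempty := by
  obtain ⟨z, hz, hzt⟩ := exists_stereo_eq (stereo (u⁻¹ * v) - 1)
  have e : u⁻¹ * (u * z) = z := by group
  have hs : stereo (u⁻¹ * (u * z)) < stereo (u⁻¹ * v) := by rw [e, hzt]; linarith
  refine ⟨u * z, ?_, ?_, h, hs⟩
  · intro h'
    exact hz (by simpa using h')
  · intro h'
    rw [h'] at hs
    exact lt_irrefl _ hs

/-- A nondegenerate open interval determines its end points. -/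
theorem arc_injective {u v u' v' : Circle} (h : u ≠ v) (he : arc u v = arc u' v') :
    u = u' ∧ v = v' := by
  have H : ∀ p, PosOriented u p v ↔ PosOriented u' p v' := fun p => by
    have := Set.ext_iff.mp he p
    exact this
  obtain ⟨q, hq⟩ := arc_nonempty h
  have hq : PosOriented u q v := hq
  have hq' := (H q).mp hq
  have key : ∀ {u v u' v' : Circle}, (∀ p, PosOriented u p v ↔ PosOriented u' p v') →
      PosOriented u q v → PosOriented u' q v' → ¬ PosOriented q v v' ∧ ¬ PosOriented q u' u := by
    intro u v u' v' H hq hq'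
    constructor
    · intro hc
      have h1 : PosOriented v v' u' := hc.inner hq'.rotate
      exact ((H v).mpr h1.rotate.rotate).2.1 rfl
    · intro hc
      have h1 : PosOriented v' u' u := PosOriented.inner hq'.rotate hc
      exact ((H u).mpr h1.rotate).1 rfl
  have k1 := key H hq hq'
  have k2 := key (fun p => (H p).symm) hq' hq
  constructor
  · by_contra hne
    rcases posOriented_total hq.1.symm hne hq'.1.symm with h | h
    · exact k2.2 h
    · exact k1.2 h
  · by_contra hne
    rcases posOriented_total hq.2.1 hne hq'.2.1 with h | h
    · exact k1.1 h
    · exact k2.1 h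

theorem dual_arc {u v : Circle} (h : u ≠ v) : dual (arc u v) = arc v u := by
  ext p
  constructor
  · rintro ⟨u', v', -, he, hp⟩
    obtain ⟨rfl, rfl⟩ := arc_injective h he
    exact hp
  · intro hp
    exact ⟨u, v, h, rfl, hp⟩

/-! ### Lamination systems -/

/-- The two point set `{I, I*}` lies on `J`. -/
def LiesOn (I J : Set Circle) : Prop := I ⊆ J ∨ dual I ⊆ J

/-- `L` is a lamination system on `S¹`. -/
structure IsLaminationSystem (L : Set (Set Circle)) : Prop where
  nonempty : L.Nonempty
  isNondegInterval : ∀ I ∈ L, IsNondegInterval I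
  dual_mem : ∀ I ∈ L, dual I ∈ L
  unlinked : ∀ I ∈ L, ∀ J ∈ L, LiesOn I J ∨ LiesOn I (dual J)
  iUnion_mem : ∀ I : ℕ → Set Circle, (∀ n, I n ∈ L) → (∀ n, I n ⊆ I (n + 1)) →
    IsNondegInterval (⋃ n, I n) → (⋃ n, I n) ∈ L

/-- `𝒢` is a leaf of `L`. -/
def IsLeaf (L 𝒢 : Set (Set Circle)) : Prop := ∃ I ∈ L, 𝒢 = {I, dual I}

/-- `𝒢` is a gap of `L`. -/
structure IsGap (L 𝒢 : Set (Set Circle)) : Prop where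
  subset : 𝒢 ⊆ L
  disjoint : ∀ I ∈ 𝒢, ∀ J ∈ 𝒢, I ≠ J → Disjoint I J
  liesOn : ∀ I ∈ L, ∃ J ∈ 𝒢, LiesOn I J

/-- The vertex set of a gap: the complement of the union of its elements. -/
def vertexSet (𝒢 : Set (Set Circle)) : Set Circle := (⋃ I ∈ 𝒢, I)ᶜ

/-- An ideal polygon of `L`: a gap with finite vertex set. -/
def IsIdealPolygon (L 𝒢 : Set (Set Circle)) : Prop := IsGap L 𝒢 ∧ (vertexSet 𝒢).Finite

/-! ### Groups of orientation preserving homeomorphisms -/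

/-- The group of orientation preserving homeomorphisms of `S¹`, under composition. -/
def HomeoPlus : Subgroup (Circle ≃ₜ Circle) where
  carrier := {f | ∀ x y z, PosOriented x y z → PosOriented (f x) (f y) (f z)}
  mul_mem' := fun {f g} hf hg x y z h => hf _ _ _ (hg _ _ _ h)
  one_mem' := fun _ _ _ h => h
  inv_mem' := by
    intro f hf x y z h
    have e : ∀ w, f (f⁻¹ w) = w := fun w => f.apply_symm_apply w
    have hinj : ∀ {a b}, a ≠ b → f⁻¹ a ≠ f⁻¹ b := fun {a b} hab h' => hab (by
      rw [← e a, h', e b])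
    rcases posOriented_total (hinj h.1) (hinj h.2.1) (hinj h.2.2.1) with h' | h'
    · exact h'
    · have h2 := hf _ _ _ h'
      rw [e, e, e] at h2
      exact absurd h2 h.asymm

/-- `L` is invariant under the group `G` of homeomorphisms. -/
def IsInvariant (G : Subgroup HomeoPlus) (L : Set (Set Circle)) : Prop :=
  ∀ I ∈ L, ∀ g ∈ G, (g : Circle ≃ₜ Circle) '' I ∈ L

/-- The image `g(𝒢) = {g(I) : I ∈ 𝒢}` of a family of sets under a homeomorphism. -/
def mapFamily (g : Circle ≃ₜ Circle) (𝒢 : Set (Set Circle)) : Set (Set Circle) :=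
  (fun I => g '' I) '' 𝒢

/-- `v_G(𝒢)`: the union of the vertex sets of all the `g(𝒢)`, for `g` in `G`. -/
def orbitVertexSet (G : Subgroup HomeoPlus) (𝒢 : Set (Set Circle)) : Set Circle :=
  ⋃ g ∈ G, vertexSet (mapFamily g 𝒢)

/-- A group is virtually abelian if it has an abelian subgroup of finite index. -/
def IsVirtuallyAbelian (Γ : Type*) [Group Γ] : Prop :=
  ∃ H : Subgroup Γ, H.FiniteIndex ∧ ∀ a ∈ H, ∀ b ∈ H, a * b = b * a

end CircleLamination

/-! The argument is a ping-pong between the members of the gap. By density each member `I` contains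
a vertex of some `g(𝒢)`. Unlinkedness then forces `I*` into `g(J)` for some member `J`, so `g` sends
every member but `J` into `I` (`IsGap.exists_nests`). Call this a nesting from `J` to `I`. Nestings
compose as long as the inner ends differ, hence survive positive powers when `I ≠ J`. A non-leaf
ideal polygon has at least three members (`IsIdealPolygon.exists_ne_ne`). This yields two nestings,
each with distinct ends, whose targets differ enough that no positive powers commute
(`Nests.not_commute`). A finite-index subgroup contains positive powers of both elements, so it is
not abelian. -/

open scoped Pointwise

namespace CircleLamination

/-! ### Ping-pong on a family of disjoint sets -/

section PingPong

variable {Γ X : Type*} [Group Γ] [MulAction Γ X] {P : Set (Set X)} {I J K M : Set X} {g h : Γ}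

/-- For a family `P` of sets, `g` carries every member of `P` but `J` into `I`, while every
member of `P` but `I` is contained in `g • J`. -/
structure Nests (P : Set (Set X)) (g : Γ) (I J : Set X) : Prop where
  subset_smul : ∀ A ∈ P, A ≠ I → A ⊆ g • J
  smul_subset : ∀ A ∈ P, A ≠ J → g • A ⊆ I

theorem Nests.inv (H : Nests P g I J) : Nests P g⁻¹ J I where
  subset_smul A hA hne := Set.subset_smul_set_iff.mpr (by simpa using H.smul_subset A hA hne)
  smul_subset A hA hne := Set.smul_set_subset_iff_subset_inv_smul_set.mpr
    (by simpa using H.subset_smul A hA hne)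

theorem Nests.mul (H : Nests P g I J) (H' : Nests P h K M) (hJ : J ∈ P) (hK : K ∈ P)
    (hne : J ≠ K) : Nests P (g * h) I M where
  subset_smul A hA hA' := by
    rw [mul_smul]
    exact (H.subset_smul A hA hA').trans (Set.smul_set_mono (H'.subset_smul J hJ hne))
  smul_subset A hA hA' := by
    rw [mul_smul]
    exact (Set.smul_set_mono (H'.smul_subset A hA hA')).trans (H.smul_subset K hK hne.symm)

theorem Nests.pow (H : Nests P g I J) (hI : I ∈ P) (hJ : J ∈ P) (hne : I ≠ J) {n : ℕ}
    (hn : 0 < n) : Nests P (g ^ n) I J := by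
  induction n, hn using Nat.le_induction with
  | base => simpa using H
  | succ n _ ih =>
    rw [pow_succ]
    exact ih.mul H hJ hI hne.symm

/-- The nonempty set `g • A` lies in both `I` and `K`, and distinct members are disjoint. -/
theorem Nests.eq_of_nests {A : Set X} (hdisj : P.PairwiseDisjoint id) (H : Nests P g I J)
    (H' : Nests P g K M) (hI : I ∈ P) (hK : K ∈ P) (hA : A ∈ P) (hne : A.Nonempty)
    (hAJ : A ≠ J) (hAM : A ≠ M) : I = K := by
  by_contra hIK
  obtain ⟨x, hx⟩ := hne
  have hx' := Set.smul_mem_smul_set (a := g) hx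
  exact Set.disjoint_left.mp (hdisj hI hK hIK) (H.smul_subset A hA hAJ hx')
    (H'.smul_subset A hA hAM hx')

/-- The products `g * h` and `h * g` nest towards `I` and `K` respectively; if they were equal,
testing on the member `K` would give `I = K`. -/
theorem Nests.not_commute (hdisj : P.PairwiseDisjoint id) (hnonempty : ∀ A ∈ P, A.Nonempty)
    (H : Nests P g I J) (H' : Nests P h K M) (hI : I ∈ P) (hJ : J ∈ P) (hK : K ∈ P) (hM : M ∈ P)
    (hIJ : I ≠ J) (hKI : K ≠ I) (hKJ : K ≠ J) (hKM : K ≠ M) : ¬ Commute g h := by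
  intro hc
  -- When `M = I` the product `h * g` has equal inner ends and does not compose; `g⁻¹`, whose target
  -- is `J`, replaces `g`.
  by_cases hMI : M = I
  · subst hMI
    have h1 := H.inv.mul H' hM hK hKM.symm
    have h2 := H'.mul H.inv hM hJ hIJ
    rw [← hc.inv_left.eq] at h2
    exact hKJ (h1.eq_of_nests hdisj h2 hJ hK hK (hnonempty K hK) hKM hKM).symm
  · have h1 := H.mul H' hJ hK hKJ.symm
    have h2 := H'.mul H hM hI hMI
    rw [← hc.eq] at h2
    exact hKI (h1.eq_of_nests hdisj h2 hI hK hK (hnonempty K hK) hKM hKJ).symm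

/-- If both given nestings return to their own member, their product goes from `J` to `I`. -/
theorem exists_nests_ne (hIJ : I ≠ J) (hI : I ∈ P) (hJ : J ∈ P)
    (hP : ∀ A ∈ P, ∃ g : Γ, ∃ B ∈ P, Nests P g A B) :
    ∃ g : Γ, ∃ A ∈ P, ∃ B ∈ P, A ≠ B ∧ Nests P g A B := by
  obtain ⟨g, A, hA, H⟩ := hP I hI
  obtain ⟨h, B, hB, H'⟩ := hP J hJ
  by_cases h1 : I = A
  · by_cases h2 : J = B
    · subst h1 h2
      exact ⟨g * h, I, hI, J, hJ, hIJ, H.mul H' hI hJ hIJ⟩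
    · exact ⟨h, J, hJ, B, hB, h2, H'⟩
  · exact ⟨g, I, hI, A, hA, h1, H⟩

theorem not_isVirtuallyAbelian_of_nests (hdisj : P.PairwiseDisjoint id)
    (hnonempty : ∀ A ∈ P, A.Nonempty) (hthree : ∀ I ∈ P, ∀ J ∈ P, ∃ K ∈ P, K ≠ I ∧ K ≠ J)
    (hne : P.Nonempty) (hP : ∀ A ∈ P, ∃ g : Γ, ∃ B ∈ P, Nests P g A B) :
    ¬ IsVirtuallyAbelian Γ := by
  rintro ⟨S, hS, hcomm⟩
  obtain ⟨I₀, hI₀⟩ := hne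
  obtain ⟨J₀, hJ₀, hne₀, -⟩ := hthree I₀ hI₀ I₀ hI₀
  obtain ⟨g, I, hI, J, hJ, hIJ, H⟩ := exists_nests_ne hne₀.symm hI₀ hJ₀ hP
  obtain ⟨K, hK, hKI, hKJ⟩ := hthree I hI J hJ
  obtain ⟨k, M, hM, hKM, H'⟩ : ∃ k : Γ, ∃ M ∈ P, K ≠ M ∧ Nests P k K M := by
    obtain ⟨k, M, hM, H'⟩ := hP K hK
    -- If `k` nests `K` with itself, composing with `g` moves the source to `J`.
    by_cases hKM : K = M
    · subst hKM
      exact ⟨k * g, J, hJ, hKJ, H'.mul H hK hI hKI⟩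
    · exact ⟨k, M, hM, hKM, H'⟩
  obtain ⟨m, hm, -, hm'⟩ := Subgroup.exists_pow_mem_of_index_ne_zero hS.index_ne_zero g
  obtain ⟨n, hn, -, hn'⟩ := Subgroup.exists_pow_mem_of_index_ne_zero hS.index_ne_zero k
  exact (H.pow hI hJ hIJ hm).not_commute hdisj hnonempty (H'.pow hK hM hKM hn) hI hJ hK hM
    hIJ hKI hKJ hKM (hcomm _ hm' _ hn')

end PingPong

/-! ### Disjointness and duality of circular intervals -/

section Intervals

theorem isOpen_arc (u v : Circle) : IsOpen (arc u v) := by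
  have e : arc u v = {p | 0 < cross u p v} := Set.ext fun p => posOriented_iff
  rw [e]
  refine isOpen_lt continuous_const ?_
  unfold cross
  fun_prop

theorem IsNondegInterval.isOpen {I : Set Circle} (hI : IsNondegInterval I) : IsOpen I := by
  obtain ⟨u, v, -, rfl⟩ := hI
  exact isOpen_arc u v

theorem IsNondegInterval.nonempty {I : Set Circle} (hI : IsNondegInterval I) : I.Nonempty := by
  obtain ⟨u, v, h, rfl⟩ := hI
  exact arc_nonempty h

theorem IsNondegInterval.dual {I : Set Circle} (hI : IsNondegInterval I) :
    IsNondegInterval (dual I) := by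
  obtain ⟨u, v, h, rfl⟩ := hI
  exact ⟨v, u, h.symm, dual_arc h⟩

theorem IsNondegInterval.dual_dual {I : Set Circle} (hI : IsNondegInterval I) :
    CircleLamination.dual (CircleLamination.dual I) = I := by
  obtain ⟨u, v, h, rfl⟩ := hI
  rw [dual_arc h, dual_arc h.symm]

theorem IsNondegInterval.disjoint_dual {I : Set Circle} (hI : IsNondegInterval I) :
    Disjoint I (CircleLamination.dual I) := by
  obtain ⟨u, v, h, rfl⟩ := hI
  rw [dual_arc h, Set.disjoint_left]
  intro p hp hp'
  exact PosOriented.asymm hp (PosOriented.rotate hp').rotate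

theorem not_disjoint_arc_of_left_mem {u v a b : Circle} (h : u ≠ v) (hu : u ∈ arc a b) :
    ¬ Disjoint (arc a b) (arc u v) := by
  have hu : PosOriented a u b := hu
  have key : ∀ p, PosOriented u p b → p ∈ arc a b := fun p hp =>
    (hp.inner hu.rotate).rotate.rotate
  -- Any point between `u` and whichever of `b`, `v` comes first after `u` will do.
  have hw : ∃ p, PosOriented u p b ∧ PosOriented u p v := by
    by_cases hbv : b = v
    · subst hbv
      obtain ⟨p, hp⟩ := arc_nonempty h
      exact ⟨p, hp, hp⟩
    · rcases posOriented_total hu.2.1 hbv h with h' | h'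
      · obtain ⟨p, hp⟩ := arc_nonempty hu.2.1
        exact ⟨p, hp, PosOriented.trans hp h'⟩
      · obtain ⟨p, hp⟩ := arc_nonempty h
        exact ⟨p, PosOriented.trans hp h', hp⟩
  obtain ⟨p, hp, hp'⟩ := hw
  exact Set.not_disjoint_iff.mpr ⟨p, key p hp, hp'⟩

theorem not_disjoint_arc_of_right_mem {u v a b : Circle} (h : u ≠ v) (hv : v ∈ arc a b) :
    ¬ Disjoint (arc a b) (arc u v) := by
  have hv : PosOriented a v b := hv
  have hw : ∃ p, PosOriented a p v ∧ PosOriented u p v := by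
    by_cases hau : a = u
    · subst hau
      obtain ⟨p, hp⟩ := arc_nonempty h
      exact ⟨p, hp, hp⟩
    · rcases posOriented_total (Ne.symm hau) hv.1 h with h' | h'
      · obtain ⟨p, hp⟩ := arc_nonempty hv.1
        exact ⟨p, hp, (PosOriented.inner hp h'.rotate).rotate.rotate⟩
      · obtain ⟨p, hp⟩ := arc_nonempty h
        exact ⟨p, (PosOriented.inner hp h').rotate.rotate, hp⟩
  obtain ⟨p, hp, hp'⟩ := hw
  exact Set.not_disjoint_iff.mpr ⟨p, hp.trans hv, hp'⟩

/-- By the two preceding lemmas `K` avoids the end points of `I` as well as `I` itself, and only the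
dual remains. -/
theorem IsNondegInterval.subset_dual {I K : Set Circle} (hI : IsNondegInterval I)
    (hK : IsNondegInterval K) (hd : Disjoint K I) : K ⊆ CircleLamination.dual I := by
  obtain ⟨u, v, h, rfl⟩ := hI
  obtain ⟨a, b, -, rfl⟩ := hK
  intro p hp
  rw [dual_arc h]
  have h1 : u ≠ p := by
    rintro rfl
    exact not_disjoint_arc_of_left_mem h hp hd
  have h2 : p ≠ v := by
    rintro rfl
    exact not_disjoint_arc_of_right_mem h hp hd
  rcases posOriented_total h1 h2 h with h' | h'
  · exact absurd h' (Set.disjoint_left.mp hd hp)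
  · exact h'.rotate

theorem map_posOriented_iff (g : HomeoPlus) {x y z : Circle} :
    PosOriented ((g : Circle ≃ₜ Circle) x) ((g : Circle ≃ₜ Circle) y)
      ((g : Circle ≃ₜ Circle) z) ↔ PosOriented x y z := by
  refine ⟨fun h => ?_, g.2 x y z⟩
  have e : ∀ w, (g : Circle ≃ₜ Circle)⁻¹ ((g : Circle ≃ₜ Circle) w) = w :=
    (g : Circle ≃ₜ Circle).symm_apply_apply
  simpa only [e] using HomeoPlus.inv_mem g.2 _ _ _ h

theorem image_arc (g : HomeoPlus) (u v : Circle) : (g : Circle ≃ₜ Circle) '' arc u v =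
    arc ((g : Circle ≃ₜ Circle) u) ((g : Circle ≃ₜ Circle) v) := by
  ext p
  obtain ⟨q, rfl⟩ := (g : Circle ≃ₜ Circle).surjective p
  rw [(g : Circle ≃ₜ Circle).injective.mem_set_image]
  exact (map_posOriented_iff g).symm

theorem IsNondegInterval.image_dual {I : Set Circle} (hI : IsNondegInterval I) (g : HomeoPlus) :
    (g : Circle ≃ₜ Circle) '' CircleLamination.dual I =
      CircleLamination.dual ((g : Circle ≃ₜ Circle) '' I) := by
  obtain ⟨u, v, h, rfl⟩ := hI
  rw [dual_arc h, image_arc, image_arc, dual_arc ((g : Circle ≃ₜ Circle).injective.ne h)]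

theorem eq_empty_of_isOpen_of_finite {U : Set Circle} (hU : IsOpen U) (hf : U.Finite) :
    U = ∅ := by
  by_contra hne
  obtain ⟨x, hx⟩ := Set.nonempty_iff_ne_empty.mpr hne
  obtain ⟨y, hy⟩ := exists_stereo_eq 0
  have : Nontrivial Circle := ⟨y, 1, hy.1⟩
  exact infinite_of_mem_nhds x (hU.mem_nhds hx) hf

end Intervals

/-! ### Gaps and the nestings they carry -/

section Gaps

variable {L 𝒢 : Set (Set Circle)}

theorem IsGap.isNondegInterval (hL : IsLaminationSystem L) (h𝒢 : IsGap L 𝒢) :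
    ∀ I ∈ 𝒢, IsNondegInterval I :=
  fun I hI => hL.isNondegInterval I (h𝒢.subset hI)

/-- An open set missing every member consists of vertices, so it is finite and hence empty. With a
single member `I`, this would make `I*` empty; with two, it makes `I*` and `J*` disjoint, so `J =
I*` and the gap is a leaf. -/
theorem IsIdealPolygon.exists_ne_ne (hL : IsLaminationSystem L) (hpoly : IsIdealPolygon L 𝒢)
    (hleaf : ¬ IsLeaf L 𝒢) {I J : Set Circle} (hI : I ∈ 𝒢) (hJ : J ∈ 𝒢) :
    ∃ K ∈ 𝒢, K ≠ I ∧ K ≠ J := by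
  obtain ⟨h𝒢, hfin⟩ := hpoly
  have hint := h𝒢.isNondegInterval hL
  have hIi := hint I hI
  have key : ∀ U : Set Circle, IsOpen U → (∀ K ∈ 𝒢, Disjoint U K) → U = ∅ := fun U hU hd =>
    eq_empty_of_isOpen_of_finite hU (hfin.subset fun p hp => by
      simp only [vertexSet, Set.mem_compl_iff, Set.mem_iUnion, not_exists]
      exact fun K hK hpK => Set.disjoint_left.mp (hd K hK) hp hpK)
  by_contra! hcon
  by_cases hJI : J = I
  · subst hJI
    refine hIi.dual.nonempty.ne_empty (key _ hIi.dual.isOpen fun K hK => ?_)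
    have : K = J := by
      by_contra hne
      exact hne (hcon K hK hne)
    subst this
    exact hIi.disjoint_dual.symm
  · have hJi := hint J hJ
    have hd : Disjoint (dual J) (dual I) := by
      rw [Set.disjoint_iff_inter_eq_empty]
      refine key _ (hJi.dual.isOpen.inter hIi.dual.isOpen) fun K hK => ?_
      by_cases hKI : K = I
      · subst hKI
        exact hIi.disjoint_dual.symm.mono_left Set.inter_subset_right
      · rw [hcon K hK hKI]
        exact hJi.disjoint_dual.symm.mono_left Set.inter_subset_left
    have h1 : dual J ⊆ I := by
      simpa only [hIi.dual_dual] using hIi.dual.subset_dual hJi.dual hd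
    have h2 : I ⊆ dual J := hJi.subset_dual hIi (h𝒢.disjoint I hI J hJ (Ne.symm hJI))
    have h3 : J = dual I := by rw [h2.antisymm h1, hJi.dual_dual]
    refine hleaf ⟨I, h𝒢.subset hI, ?_⟩
    ext K
    constructor
    · intro hK
      by_cases hKI : K = I
      · exact Or.inl hKI
      · exact Or.inr ((hcon K hK hKI).trans h3)
    · rintro (rfl | hK)
      · exact hI
      · rw [Set.mem_singleton_iff] at hK
        rw [hK, ← h3]
        exact hJ

/-- The action on the circle of a group of orientation preserving homeomorphisms. -/
@[reducible] noncomputable def circleAction (G : Subgroup HomeoPlus) : MulAction G Circle where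
  smul g x := ((g : HomeoPlus) : Circle ≃ₜ Circle) x
  one_smul _ := rfl
  mul_smul _ _ _ := rfl

attribute [local instance] circleAction

theorem smul_eq_image {G : Subgroup HomeoPlus} (g : G) (I : Set Circle) :
    g • I = ((g : HomeoPlus) : Circle ≃ₜ Circle) '' I := rfl

theorem IsGap.exists_nests {G : Subgroup HomeoPlus} (hL : IsLaminationSystem L)
    (hGL : IsInvariant G L) (h𝒢 : IsGap L 𝒢) (hdense : Dense (orbitVertexSet G 𝒢))
    {I : Set Circle} (hI : I ∈ 𝒢) : ∃ g : G, ∃ J ∈ 𝒢, Nests 𝒢 g I J := by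
  have hint := h𝒢.isNondegInterval hL
  have hIi := hint I hI
  obtain ⟨v, hvI, hv⟩ := hdense.inter_open_nonempty I hIi.isOpen hIi.nonempty
  obtain ⟨γ, hγ, hv⟩ : ∃ g, ∃ _ : g ∈ G, v ∈ vertexSet (mapFamily g 𝒢) := by
    simpa only [orbitVertexSet, Set.mem_iUnion] using hv
  set g : G := ⟨γ, hγ⟩
  have hv' : ∀ K ∈ 𝒢, v ∉ g • K := by
    intro K hK hvK
    exact hv (Set.mem_biUnion (Set.mem_image_of_mem _ hK) hvK)
  obtain ⟨J, hJ, h | h⟩ := h𝒢.liesOn (g⁻¹ • I) (hGL I (h𝒢.subset hI) _ g⁻¹.2)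
  -- Here `I ⊆ g • J`, although the point `v` of `I` is a vertex of the translated gap.
  · exact absurd (Set.smul_set_subset_iff_subset_inv_smul_set.mp h hvI) (by simpa using hv' J hJ)
  · rw [smul_eq_image, ← hIi.image_dual, ← smul_eq_image] at h
    have h : dual I ⊆ g • J := by
      simpa using Set.smul_set_subset_iff_subset_inv_smul_set.mp h
    refine ⟨g, J, hJ, fun K hK hKI => ?_, fun K hK hKJ => ?_⟩
    · exact (hIi.subset_dual (hint K hK) (h𝒢.disjoint K hK I hI hKI)).trans h
    · have hd : Disjoint (g • K) (dual I) :=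
        ((Set.disjoint_image_iff (MulAction.injective g)).mpr
          (h𝒢.disjoint K hK J hJ hKJ)).mono_right h
      have hgK : IsNondegInterval (g • K) :=
        hL.isNondegInterval _ (hGL K (h𝒢.subset hK) _ g.2)
      simpa only [hIi.dual_dual] using hIi.dual.subset_dual hgK hd

theorem IsIdealPolygon.not_isVirtuallyAbelian {G : Subgroup HomeoPlus}
    (hL : IsLaminationSystem L) (hGL : IsInvariant G L) (hpoly : IsIdealPolygon L 𝒢)
    (hleaf : ¬ IsLeaf L 𝒢) (hdense : Dense (orbitVertexSet G 𝒢)) : ¬ IsVirtuallyAbelian G := by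
  have h𝒢 := hpoly.1
  obtain ⟨I, hI⟩ := hL.nonempty
  obtain ⟨J, hJ, -⟩ := h𝒢.liesOn I hI
  exact not_isVirtuallyAbelian_of_nests h𝒢.disjoint
    (fun A hA => (h𝒢.isNondegInterval hL A hA).nonempty)
    (fun A hA B hB => hpoly.exists_ne_ne hL hleaf hA hB) ⟨J, hJ⟩
    (fun A hA => h𝒢.exists_nests hL hGL hdense hA)

end Gaps

end CircleLamination

theorem mainTheorem1 (G : Subgroup CircleLamination.HomeoPlus) (L : Set (Set Circle))
    (hL : CircleLamination.IsLaminationSystem L)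
    (hGL : CircleLamination.IsInvariant G L)
    (𝒢₀ : Set (Set Circle))
    (hpoly : CircleLamination.IsIdealPolygon L 𝒢₀)
    (hleaf : ¬ CircleLamination.IsLeaf L 𝒢₀)
    (hdense : Dense (CircleLamination.orbitVertexSet G 𝒢₀)) :
    ¬ CircleLamination.IsVirtuallyAbelian G :=
  hpoly.not_isVirtuallyAbelian hL hGL hleaf hdense
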